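/- Let $d\ge 1$ and $p\in(0,1)$. Let $X=\mathbb T^d$ with angle coordinates $x=(\theta^1,\dots,\theta^d)$ modulo $2\pi$ (identified with $(\mathbb R/\mathbb Z)^d$ by $\theta^i=2\pi x_i$), and let $\phi_j(x)=\prod_{i=1}^d e^{\mathrm i j_i\theta^i}$ for $j\in\mathbb Z^d$. Let $|\cdot|$ be any norm on $\mathbb R^d$. For a continuous $f:X\to\mathbb C$ with Fourier coefficients $\hat f_m$ and $M\in\mathbb N$ put $f^{(M)}=\sum_{m\in\mathbb Z^d,\ |m|\le M}\hat f_m\phi_m$. **The quantum states.** For $\tau>0$ put $|j|_p=\sum_{i=1}^d|j_i|^p$ and $\psi_{j}=e^{-\tau|j|_p/2}\phi_j$. Let $n=dq$ with an integer $q\ge 1$, $J_{n,d}=\{-2^{q-1},\dots,-1,1,\dots,2^{q-1}\}$ and $J_n=(J_{n,d})^d\subset\mathbb Z^d$. Let $\mathcal H_{\tau,n}$ be the span of the $\psi_j$, $j\in J_n$, with the inner product for which they are orthonormal; it is a reproducing kernel Hilbert space with kernel sections $k_{x,n}=\sum_{j\in J_n}\overline{\psi_j(x)}\,\psi_j$.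 Let $\kappa_n=\sum_{j\in J_n}e^{-\tau|j|_p}$, $\xi_{x,n}=k_{x,n}/\sqrt{\kappa_n}$, and let $\rho_{x,\tau,n}=\langle\xi_{x,n},\cdot\rangle\,\xi_{x,n}$ be the corresponding pure state. Let $\mathbb B_n=(\mathbb C^2)^{\otimes n}$ have the computational basis $|\boldsymbol b\rangle$, where $\boldsymbol b=(\boldsymbol b^{(1)},\dots,\boldsymbol b^{(d)})$ consists of $d$ binary strings of length $q$; each $\boldsymbol b^{(i)}$ is also read as an integer in $\{0,\dots,2^q-1\}$, most significant digit first. Let $o:J_{n,d}\to\{0,\dots,2^q-1\}$ be the increasing bijection, and let $W_n:\mathcal H_{\tau,n}\to\mathbb B_n$ be the unitary map with $W_n\psi_j=|o(j_1),\dots,o(j_d)\rangle$. Let $\mathfrak F_{n,d}=\mathfrak F_q^{\otimes d}$, where $\mathfrak F_q|m\rangle=2^{-q/2}\sum_{l=0}^{2^q-1}e^{-2\pi\mathrm i lm/2^q}|l\rangle$, and put $$\tilde\rho_{x,\tau,n}=\mathfrak F_{n,d}^*\,W_n\,\rho_{x,\tau,n}\,W_n^*\,\mathfrak F_{n,d}.$$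 **The observables.** Let $x_{\boldsymbol b}\in X$ be the dyadic grid point with angles $\theta^i=2\pi\boldsymbol b^{(i)}/2^{q}$, and let $D^{(M)}_{\tau,n}$ and $E^{(M)}_{\tau,n}$ be the diagonal operators on $\mathbb B_n$ with $$D^{(M)}_{\tau,n}|\boldsymbol b\rangle=f^{(M)}(x_{\boldsymbol b})\,|\boldsymbol b\rangle,\qquad E^{(M)}_{\tau,n}|\boldsymbol b\rangle=\operatorname{Re}f^{(M)}(x_{\boldsymbol b})\,|\boldsymbol b\rangle.$$ Write $\langle A\rangle_\rho=\operatorname{tr}(\rho A)$. **Theorem.** Let $f$ belong to the Wiener algebra of $X$, i.e. $f$ is continuous and $\sum_{m\in\mathbb Z^d}|\hat f_m|<\infty$. Then there is a strictly decreasing sequence $(\tau_M)_{M\in\mathbb N}$ of positive numbers with $\tau_M\to0$ such that $$\lim_{M\to\infty}\ \lim_{n\to\infty}\ \langle D^{(M)}_{\tau_M,n}\rangle_{\tilde\rho_{x,\tau_M,n}}=f(x),\qquad \lim_{M\to\infty}\ \lim_{n\to\infty}\ \langle E^{(M)}_{\tau_M,n}\rangle_{\tilde\rho_{x,\tau_M,n}}=\operatorname{Re}f(x),$$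 where $n$ runs through the positive multiples of $d$. In each case the inner limits exist for every $M$, and both the inner limit (for each fixed $M$) and the outer limit are uniform in $x\in X$. -/

import Mathlib

open Filter Topology ComplexConjugate
open scoped BigOperators

namespace QECD

noncomputable section

/-- The torus `𝕋^d`, written as `(ℝ/ℤ)^d`: the canonical angle coordinates of `x` are
`θ^i = 2π x i`, and the Fourier function `φ_j (x) = ∏ i, e^{i j_i θ^i}` is
`UnitAddTorus.mFourier j x`. -/
abbrev Torus (d : ℕ) : Type := UnitAddTorus (Fin d)

/-! ### Classical observables -/

/-- Membership in the Wiener algebra: the Fourier series of `f` is absolutely convergent. -/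
def IsWiener {d : ℕ} (f : C(Torus d, ℂ)) : Prop :=
  Summable fun m : Fin d → ℤ => ‖UnitAddTorus.mFourierCoeff f m‖

/-- The bandlimited observable `f^(M) = ∑_{|m| ≤ M} f̂_m φ_m`, where `|·|` is the norm `ν` on `ℝ^d`
(there are finitely many such `m`). -/
def bandlimit {d : ℕ} (ν : Seminorm ℝ (Fin d → ℝ)) (f : C(Torus d, ℂ)) (M : ℕ) (x : Torus d) : ℂ :=
  ∑ᶠ (m : Fin d → ℤ) (_ : ν (fun i => (m i : ℝ)) ≤ M),
    UnitAddTorus.mFourierCoeff f m * UnitAddTorus.mFourier m x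

/-! ### The reproducing kernel Hilbert space `𝓗_{τ,n}`

The number of qubits is `n = d * q`, with `q` qubits for each dimension of the torus. -/

/-- `|j|_p = |j_1|^p + ⋯ + |j_d|^p`. -/
def pAbs {d : ℕ} (p : ℝ) (j : Fin d → ℤ) : ℝ := ∑ i, |(j i : ℝ)| ^ p

/-- The scaled Fourier function `ψ_j = e^{-τ |j|_p / 2} φ_j`. -/
def psi {d : ℕ} (p τ : ℝ) (j : Fin d → ℤ) (x : Torus d) : ℂ :=
  (Real.exp (-τ * pAbs p j / 2) : ℂ) * UnitAddTorus.mFourier j x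

/-- The index set `{-2^{q-1}, …, -1, 1, …, 2^{q-1}}` of one torus dimension. -/
def freqs₁ (q : ℕ) : Finset ℤ := (Finset.Icc (-2 ^ (q - 1)) (2 ^ (q - 1))).erase 0

/-- The index set `J_n` of all `(j_1, …, j_d)` with every `j_i` in `freqs₁ q`. -/
def freqs (d q : ℕ) : Finset (Fin d → ℤ) := Fintype.piFinset fun _ => freqs₁ q

/-- The Hilbert space `𝓗_{τ,n} = span {ψ_j : j ∈ J_n}`, in which the functions `ψ_j` are
orthonormal. An element is given by its coefficients with respect to the `ψ_j`; the function on
the torus which it is, is `FeatureSpace.toFunction`. -/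
abbrev FeatureSpace (d q : ℕ) : Type := EuclideanSpace ℂ (freqs d q)

/-- The basis vector `ψ_j` of `𝓗_{τ,n}`. -/
def FeatureSpace.basisVec {d q : ℕ} (j : freqs d q) : FeatureSpace d q := EuclideanSpace.single j 1

/-- The function on the torus with given coefficients with respect to the `ψ_j`. -/
def FeatureSpace.toFunction {d q : ℕ} (p τ : ℝ) : FeatureSpace d q →ₗ[ℂ] (Torus d → ℂ) where
  toFun h x := ∑ j : freqs d q, h j * psi p τ j x
  map_add' g h := by
    funext x
    simp [add_mul, Finset.sum_add_distrib]
  map_smul' c h := by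
    funext x
    simp [mul_assoc, Finset.mul_sum]

theorem FeatureSpace.toFunction_basisVec {d q : ℕ} (p τ : ℝ) (j : freqs d q) :
    FeatureSpace.toFunction p τ (FeatureSpace.basisVec j) = psi p τ j := by
  funext x
  simp [FeatureSpace.toFunction, FeatureSpace.basisVec]

theorem FeatureSpace.toFunction_injective {d q : ℕ} (p τ : ℝ) :
    Function.Injective (FeatureSpace.toFunction (d := d) (q := q) p τ) := by
  rw [injective_iff_map_eq_zero]
  intro h hh
  have hli : LinearIndependent ℂ (fun j : Fin d → ℤ => UnitAddTorus.mFourier j) := by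
    have h2 := (UnitAddTorus.orthonormal_mFourier (d := Fin d)).linearIndependent
    exact LinearIndependent.of_comp (ContinuousMap.toLp (E := ℂ) 2
      (MeasureTheory.Measure.pi fun _ : Fin d => AddCircle.haarAddCircle) ℂ).toLinearMap h2
  have hli' : LinearIndependent ℂ
      (fun j : freqs d q => UnitAddTorus.mFourier (j : Fin d → ℤ)) :=
    hli.comp _ Subtype.val_injective
  rw [Fintype.linearIndependent_iff] at hli'
  have := hli' (fun j => h j * (Real.exp (-τ * pAbs p (j : Fin d → ℤ) / 2) : ℂ)) (by
    ext x
    have hx := congrFun hh x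
    simp only [FeatureSpace.toFunction, psi, LinearMap.coe_mk, AddHom.coe_mk, Pi.zero_apply] at hx
    simpa [ContinuousMap.sum_apply, mul_assoc] using hx)
  ext j
  have hj := this j
  rcases mul_eq_zero.1 hj with h0 | h0
  · exact h0
  · exact absurd (Complex.ofReal_eq_zero.1 h0) (Real.exp_ne_zero _)

/-- The section `k_{x,n} = ∑_{j ∈ J_n} ψ_j^*(x) ψ_j` of the reproducing kernel. -/
def kernelSection {d q : ℕ} (p τ : ℝ) (x : Torus d) : FeatureSpace d q :=
  ∑ j : freqs d q, conj (psi p τ j x) • FeatureSpace.basisVec j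

theorem inner_kernelSection {d q : ℕ} (p τ : ℝ) (x : Torus d) (h : FeatureSpace d q) :
    inner ℂ (kernelSection p τ x) h = FeatureSpace.toFunction p τ h x := by
  simp [kernelSection, FeatureSpace.basisVec, FeatureSpace.toFunction,
    EuclideanSpace.inner_single_left, mul_comm]

/-- `κ_n = k_n(x, x) = ∑_{j ∈ J_n} e^{-τ |j|_p}`. -/
def kappa (d q : ℕ) (p τ : ℝ) : ℝ := ∑ j ∈ freqs d q, Real.exp (-τ * pAbs p j)

/-- The normalized feature vector `ξ_{x,n} = k_{x,n} / √κ_n`. -/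
def featureVec {d q : ℕ} (p τ : ℝ) (x : Torus d) : FeatureSpace d q :=
  ((Real.sqrt (kappa d q p τ))⁻¹ : ℂ) • kernelSection p τ x

/-- The quantum feature state `ρ_{x,τ,n} = ⟨ξ_{x,n}, ·⟩ ξ_{x,n}`. -/
def featureState {d q : ℕ} (p τ : ℝ) (x : Torus d) : FeatureSpace d q →ₗ[ℂ] FeatureSpace d q :=
  (InnerProductSpace.rankOne ℂ (featureVec p τ x) (featureVec p τ x)).toLinearMap

/-! ### The quantum computational system -/

/-- Binary strings `(b^(1), …, b^(d))` of length `n = d * q`, cut into `d` blocks of length `q`. -/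
abbrev Bits (d q : ℕ) : Type := Fin d → Fin q → Bool

/-- The `n`-qubit space `𝔹_n`, with its computational basis indexed by binary strings. -/
abbrev Qubits (d q : ℕ) : Type := EuclideanSpace ℂ (Bits d q)

/-- The computational basis vector `|b⟩`. -/
def ket {d q : ℕ} (b : Bits d q) : Qubits d q := EuclideanSpace.single b 1

/-- The string of the `q` binary digits of `k`, most significant digit first. -/
def toBits (q k : ℕ) : Fin q → Bool := fun i => k.testBit i.rev

/-- The integer `∑ i, b_i 2^{q-i}` represented by a binary string (with `i = 1, …, q`). -/
def ofBits {q : ℕ} (b : Fin q → Bool) : ℕ := ∑ i, if b i then 2 ^ (i.rev : ℕ) else 0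

/-- The increasing enumeration `o : freqs₁ q → {0, …, 2^q - 1}`. -/
def enum (q : ℕ) (j : ℤ) : ℕ :=
  if j < 0 then (j + 2 ^ (q - 1)).toNat else (j + 2 ^ (q - 1) - 1).toNat

/-- The unitary `W_n : 𝓗_n → 𝔹_n` with `W_n ψ_j = |η(j_1), …, η(j_d)⟩`, where `η(j_i)` is the binary
string of `o(j_i)`. -/
def W (d q : ℕ) : FeatureSpace d q →ₗ[ℂ] Qubits d q :=
  (EuclideanSpace.basisFun (freqs d q) ℂ).toBasis.constr ℂ fun j =>
    ket fun i => toBits q (enum q ((j : Fin d → ℤ) i))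

/-- The matrix element `⟨c| 𝔉_q |b⟩ = 2^{-q/2} e^{-2πi b c / 2^q}` of the quantum Fourier transform
on `q` qubits. -/
def qftEntry {q : ℕ} (c b : Fin q → Bool) : ℂ :=
  ((Real.sqrt (2 ^ q))⁻¹ : ℂ) *
    Complex.exp (-2 * Real.pi * Complex.I * (ofBits b : ℂ) * (ofBits c : ℂ) / 2 ^ q)

/-- The tensor product `𝔉_{n,d} = 𝔉_q ⊗ ⋯ ⊗ 𝔉_q` of `d` quantum Fourier transforms. -/
def qft (d q : ℕ) : Qubits d q →ₗ[ℂ] Qubits d q :=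
  (EuclideanSpace.basisFun (Bits d q) ℂ).toBasis.constr ℂ fun b =>
    ∑ c, (∏ i, qftEntry (c i) (b i)) • ket c

/-- The quantum computational state `ρ̂_{x,τ,n} = W_n ρ_{x,τ,n} W_n^*`. -/
def compState {d : ℕ} (q : ℕ) (p τ : ℝ) (x : Torus d) : Qubits d q →ₗ[ℂ] Qubits d q :=
  W d q ∘ₗ featureState p τ x ∘ₗ LinearMap.adjoint (W d q)

/-- The state `ρ̃_{x,τ,n} = 𝔉_{n,d}^* ρ̂_{x,τ,n} 𝔉_{n,d}` after the quantum Fourier rotation. -/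
def rotatedState {d : ℕ} (q : ℕ) (p τ : ℝ) (x : Torus d) : Qubits d q →ₗ[ℂ] Qubits d q :=
  LinearMap.adjoint (qft d q) ∘ₗ compState q p τ x ∘ₗ qft d q

/-- The point `x_b` of the dyadic grid, with angles `θ^i = 2π b^(i) / 2^q`. -/
def gridPoint {d q : ℕ} (b : Bits d q) : Torus d :=
  fun i => (((ofBits (b i) : ℝ) / 2 ^ q : ℝ) : UnitAddCircle)

/-- The diagonal observable with `|b⟩ ↦ g(x_b) |b⟩`. -/
def diagObs {d : ℕ} (q : ℕ) (g : Torus d → ℂ) : Qubits d q →ₗ[ℂ] Qubits d q :=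
  (EuclideanSpace.basisFun (Bits d q) ℂ).toBasis.constr ℂ fun b => g (gridPoint b) • ket b

/-- The diagonal observable `D^(M)_{τ,n}` with `|b⟩ ↦ f^(M)(x_b) |b⟩` (the same for all `τ`). -/
def obsD {d : ℕ} (q : ℕ) (ν : Seminorm ℝ (Fin d → ℝ)) (f : C(Torus d, ℂ)) (M : ℕ) :
    Qubits d q →ₗ[ℂ] Qubits d q :=
  diagObs q (bandlimit ν f M)

/-- The diagonal observable `E^(M)_{τ,n}` with `|b⟩ ↦ Re f^(M)(x_b) |b⟩` (the same for all `τ`). -/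
def obsE {d : ℕ} (q : ℕ) (ν : Seminorm ℝ (Fin d → ℝ)) (f : C(Torus d, ℂ)) (M : ℕ) :
    Qubits d q →ₗ[ℂ] Qubits d q :=
  diagObs q fun x => ((bandlimit ν f M x).re : ℂ)

/-- The expectation `⟨A⟩_ρ = tr (ρ A)`. -/
def expectation {d q : ℕ} (ρ A : Qubits d q →ₗ[ℂ] Qubits d q) : ℂ :=
  LinearMap.trace ℂ (Qubits d q) (ρ ∘ₗ A)

end

end QECD

/-!
Put `v = 𝔉^* W ξ_x`. Since `ρ̃_x` is the rank one operator of `v`, the expectation of a diagonal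
observable is the sum over the dyadic grid of its values against `|v_b|²` (`expectation_diagObs`).
The frequency sets, the weights `e^{-τ|j|_p}` and the quantum Fourier transform are products over
the `d` coordinates, so the expectation of a Fourier function `φ_m` is a product of expectations on
circles (`expectation_mFourier`).

On the circle, label the frequencies `a ≠ 0` as `a = skip u` with `u ∈ [-2^{q-1}, 2^{q-1})`, so that
`o(a) = u + 2^{q-1}`, and write `ψ_u` for `ψ_{skip u}`. Plancherel on
`ℤ/2^q` turns the expectation of `φ_m` into the cyclic correlation `κ⁻¹ ∑_u ψ_u^* ψ_{u+m}`, with `u + m` taken modulo `2^q` (`charMean_eq`). The weights are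
summable over `ℤ`, hence by dominated convergence in the Banach space of continuous functions this
tends uniformly to the correlation `charLimit` over all of `ℤ` (`tendsto_cyclicCorrelation`).

As `τ → 0`, `charLimit` tends uniformly to `φ_m` (`tendsto_charLimit`). The shift by `m` changes a
frequency by exactly `m` unless it crosses the missing frequency `0`, which happens for boundedly
many `u` and is negligible because `κ → ∞`. The weights at `u` and `u + m` have a ratio tending to
`1` uniformly in `u`, because `||a|^p - |b|^p| ≤ |a - b|^p` for `p ≤ 1`.

By linearity the inner limit for `f^(M)` exists uniformly, and it tends to `f^(M)` as `τ → 0`. As `f`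
lies in the Wiener algebra, `f^(M) → f` uniformly, and `τ_M` is chosen by a diagonal argument
(`exists_strictAnti_tendsto_diagonal`). The expectation of `E^(M)` is the real part of that of
`D^(M)`, because the weights `|v_b|²` are real.
-/

namespace QECD

noncomputable section

/-! ### Expectations as weighted sums over the dyadic grid -/

/-- The complex conjugate of the amplitude at `|b⟩` of the rotated feature vector of a
one-dimensional torus. -/
def amplitude (q : ℕ) (p τ : ℝ) (y : UnitAddCircle) (b : Fin q → Bool) : ℂ :=
  ∑ a ∈ freqs₁ q, ((Real.sqrt (∑ a ∈ freqs₁ q, Real.exp (-τ * |(a : ℝ)| ^ p)))⁻¹ : ℂ) *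
    ((Real.exp (-τ * |(a : ℝ)| ^ p / 2) : ℂ) * fourier a y) * qftEntry (toBits q (enum q a)) b

theorem kappa_eq_prod (d q : ℕ) (p τ : ℝ) :
    kappa d q p τ = ∏ _i : Fin d, ∑ a ∈ freqs₁ q, Real.exp (-τ * |(a : ℝ)| ^ p) := by
  rw [kappa, freqs, Finset.prod_univ_sum]
  refine Finset.sum_congr rfl fun j _ => ?_
  rw [pAbs, Finset.mul_sum, Real.exp_sum]

theorem psi_eq_prod {d : ℕ} (p τ : ℝ) (j : Fin d → ℤ) (x : Torus d) :
    psi p τ j x = ∏ i, ((Real.exp (-τ * |(j i : ℝ)| ^ p / 2) : ℂ) * fourier (j i) (x i)) := by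
  rw [psi, Finset.prod_mul_distrib, ← Complex.ofReal_prod, ← Real.exp_sum, pAbs, Finset.mul_sum,
    Finset.sum_div]
  rfl

theorem W_basisVec {d q : ℕ} (j : freqs d q) :
    W d q (FeatureSpace.basisVec j) = ket fun i => toBits q (enum q ((j : Fin d → ℤ) i)) := by
  have := (EuclideanSpace.basisFun (freqs d q) ℂ).toBasis.constr_basis ℂ
    (fun j => (ket fun i => toBits q (enum q ((j : Fin d → ℤ) i)) : Qubits d q)) j
  simpa only [W, FeatureSpace.basisVec, OrthonormalBasis.coe_toBasis,
    EuclideanSpace.basisFun_apply] using this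

theorem qft_ket {d q : ℕ} (b : Bits d q) :
    qft d q (ket b) = ∑ c, (∏ i, qftEntry (c i) (b i)) • ket c := by
  have := (EuclideanSpace.basisFun (Bits d q) ℂ).toBasis.constr_basis ℂ
    (fun b => (∑ c, (∏ i, qftEntry (c i) (b i)) • ket c : Qubits d q)) b
  simpa only [qft, ket, OrthonormalBasis.coe_toBasis, EuclideanSpace.basisFun_apply] using this

theorem diagObs_ket {d q : ℕ} (g : Torus d → ℂ) (b : Bits d q) :
    diagObs q g (ket b) = g (gridPoint b) • ket b := by
  have := (EuclideanSpace.basisFun (Bits d q) ℂ).toBasis.constr_basis ℂ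
    (fun b => (g (gridPoint b) • ket b : Qubits d q)) b
  simpa only [diagObs, ket, OrthonormalBasis.coe_toBasis, EuclideanSpace.basisFun_apply] using this

theorem inner_ket {d q : ℕ} (b : Bits d q) (v : Qubits d q) : inner ℂ (ket b) v = v b := by
  simp [ket, EuclideanSpace.inner_single_left]

theorem inner_W_featureVec {d q : ℕ} (p τ : ℝ) (x : Torus d) (v : Qubits d q) :
    inner ℂ (W d q (featureVec p τ x)) v = ∑ j : freqs d q,
      ((Real.sqrt (kappa d q p τ))⁻¹ : ℂ) * psi p τ j x *
        v (fun i => toBits q (enum q ((j : Fin d → ℤ) i))) := by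
  simp only [featureVec, kernelSection, map_smul, map_sum, W_basisVec, inner_smul_left, sum_inner,
    inner_ket, Finset.mul_sum, mul_assoc]
  simp

/-- The rotated feature vector `𝔉^* W ξ_x`. -/
def rotatedVec {d : ℕ} (q : ℕ) (p τ : ℝ) (x : Torus d) : Qubits d q :=
  LinearMap.adjoint (qft d q) (W d q (featureVec p τ x))

/-- The amplitudes of the rotated feature vector factor over the coordinates of the torus. -/
theorem inner_rotatedVec_ket {d q : ℕ} (p τ : ℝ) (x : Torus d) (b : Bits d q) :
    inner ℂ (rotatedVec q p τ x) (ket b) = ∏ i, amplitude q p τ (x i) (b i) := by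
  have hq (c : Bits d q) : qft d q (ket b) c = ∏ i, qftEntry (c i) (b i) := by
    rw [qft_ket]
    simp [ket, Pi.single_apply]
  rw [rotatedVec, LinearMap.adjoint_inner_left, inner_W_featureVec]
  simp only [hq, amplitude]
  rw [Finset.prod_univ_sum, ← freqs, ← Finset.sum_coe_sort (freqs d q)]
  refine Finset.sum_congr rfl fun j _ => ?_
  rw [Finset.prod_mul_distrib, Finset.prod_mul_distrib, ← psi_eq_prod]
  congr 2
  rw [kappa_eq_prod]
  set S := ∑ a ∈ freqs₁ q, Real.exp (-τ * |(a : ℝ)| ^ p) with hS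
  have hS0 : 0 ≤ S := Finset.sum_nonneg fun a _ => (Real.exp_pos _).le
  have hsqrt : Real.sqrt (S ^ d) = Real.sqrt S ^ d := by
    rw [← Real.sqrt_sq (pow_nonneg (Real.sqrt_nonneg S) d), ← pow_mul, mul_comm, pow_mul,
      Real.sq_sqrt hS0]
  simp [hsqrt]

theorem rotatedState_eq {d q : ℕ} (p τ : ℝ) (x : Torus d) :
    rotatedState q p τ x =
      (InnerProductSpace.rankOne ℂ (rotatedVec q p τ x) (rotatedVec q p τ x)).toLinearMap := by
  ext1 v
  simp [rotatedState, compState, featureState, rotatedVec, LinearMap.adjoint_inner_left,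
    LinearMap.adjoint_inner_right]

theorem expectation_diagObs {d q : ℕ} (p τ : ℝ) (x : Torus d) (g : Torus d → ℂ) :
    expectation (rotatedState q p τ x) (diagObs q g) =
      ∑ b : Bits d q, g (gridPoint b) * (∏ i, ‖amplitude q p τ (x i) (b i)‖ ^ 2 : ℝ) := by
  set v := rotatedVec q p τ x with hv
  have hD : diagObs q g v = ∑ b, (v b * g (gridPoint b)) • ket b := by
    conv_lhs => rw [← (EuclideanSpace.basisFun (Bits d q) ℂ).sum_repr v]
    rw [map_sum]
    refine Finset.sum_congr rfl fun b _ => ?_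
    rw [map_smul, EuclideanSpace.basisFun_apply, ← ket, diagObs_ket, smul_smul]
    rfl
  rw [expectation, LinearMap.trace_comp_comm', rotatedState_eq, ← hv]
  have : diagObs q g ∘ₗ (InnerProductSpace.rankOne ℂ v v).toLinearMap =
      (InnerProductSpace.rankOne ℂ (diagObs q g v) v).toLinearMap := by
    ext1 w; simp
  rw [this, InnerProductSpace.trace_rankOne, hD, inner_sum]
  refine Finset.sum_congr rfl fun b _ => ?_
  have hvb : v b = conj (inner ℂ v (ket b)) := by rw [inner_conj_symm, inner_ket]
  rw [inner_smul_right, hvb, hv, inner_rotatedVec_ket, Finset.prod_pow, ← norm_prod,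
    ← Complex.normSq_eq_norm_sq, ← Complex.mul_conj]
  ring

/-- The expectation of the Fourier function `φ_m` of the circle in the rotated feature state at
`y`. -/
def charMean (q : ℕ) (p τ : ℝ) (m : ℤ) (y : UnitAddCircle) : ℂ :=
  ∑ b : Fin q → Bool, fourier m (((ofBits b : ℝ) / 2 ^ q : ℝ) : UnitAddCircle) *
    (‖amplitude q p τ y b‖ ^ 2 : ℝ)

theorem expectation_mFourier {d q : ℕ} (p τ : ℝ) (x : Torus d) (m : Fin d → ℤ) :
    expectation (rotatedState q p τ x) (diagObs q (UnitAddTorus.mFourier m)) =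
      ∏ i, charMean q p τ (m i) (x i) := by
  simp only [expectation_diagObs, charMean]
  rw [Finset.prod_univ_sum, Fintype.piFinset_univ]
  refine Finset.sum_congr rfl fun b _ => ?_
  rw [Finset.prod_mul_distrib, Complex.ofReal_prod]
  rfl

theorem expectation_re {d q : ℕ} (p τ : ℝ) (x : Torus d) (g : Torus d → ℂ) :
    expectation (rotatedState q p τ x) (diagObs q fun y => ((g y).re : ℂ)) =
      ((expectation (rotatedState q p τ x) (diagObs q g)).re : ℂ) := by
  simp only [expectation_diagObs, Complex.re_sum, Complex.re_mul_ofReal]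
  push_cast
  rfl

/-! ### Binary strings and the discrete Fourier transform -/

/-- `ofBits` reads the most significant digit first, `Nat.ofBits` the least significant one. -/
theorem ofBits_eq_natOfBits {q : ℕ} (b : Fin q → Bool) :
    ofBits b = Nat.ofBits fun i => b i.rev := by
  have key : ∀ (q : ℕ) (c : Fin q → Bool),
      ∑ i, (if c i then 2 ^ (i : ℕ) else 0) = Nat.ofBits c := by
    intro q
    induction q with
    | zero => intro c; simp
    | succ q ih =>
      intro c
      rw [Nat.ofBits_succ, Fin.sum_univ_succ, ← ih, Finset.mul_sum, add_comm]
      congr 1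
      · refine Finset.sum_congr rfl fun i _ => ?_
        simp [pow_succ, mul_comm]
      · cases c 0 <;> simp
  rw [← key, ofBits]
  exact (Equiv.sum_comp Fin.revPerm (fun i : Fin q => if b i then 2 ^ (i.rev : ℕ) else 0)).symm.trans
    (by simp [Fin.revPerm_apply])

theorem ofBits_toBits {q k : ℕ} (hk : k < 2 ^ q) : ofBits (toBits q k) = k := by
  rw [ofBits_eq_natOfBits]
  simp only [toBits, Fin.rev_rev]
  rw [Nat.ofBits_testBit, Nat.mod_eq_of_lt hk]

theorem sum_ofBits {q : ℕ} {E : Type*} [AddCommMonoid E] (F : ℕ → E) :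
    ∑ b : Fin q → Bool, F (ofBits b) = ∑ k ∈ Finset.range (2 ^ q), F k := by
  have hlt (b : Fin q → Bool) : ofBits b < 2 ^ q := by
    rw [ofBits_eq_natOfBits]; exact Nat.ofBits_lt_two_pow _
  let e : (Fin q → Bool) → Fin (2 ^ q) := fun b => ⟨ofBits b, hlt b⟩
  have he : Function.Bijective e := by
    rw [Fintype.bijective_iff_surjective_and_card]
    exact ⟨fun k => ⟨toBits q k, Fin.ext (ofBits_toBits k.2)⟩, by simp⟩
  rw [Finset.sum_range]
  exact Fintype.sum_bijective e he _ _ fun _ => rfl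

/-- Orthogonality of the characters of `ℤ/Q`. -/
theorem sum_exp_eq_ite {Q : ℕ} (hQ : Q ≠ 0) (t : ℤ) :
    ∑ k ∈ Finset.range Q, Complex.exp (2 * Real.pi * Complex.I * t * k / Q) =
      if (Q : ℤ) ∣ t then (Q : ℂ) else 0 := by
  have hQ' : (Q : ℂ) ≠ 0 := by exact_mod_cast hQ
  set ζ := Complex.exp (2 * Real.pi * Complex.I * t / Q) with hζ
  have h1 (k : ℕ) : Complex.exp (2 * Real.pi * Complex.I * t * k / Q) = ζ ^ k := by
    rw [hζ, ← Complex.exp_nat_mul]; congr 1; ring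
  have hpow : ζ ^ Q = 1 := by
    rw [← h1, Complex.exp_eq_one_iff]
    exact ⟨t, by field_simp⟩
  have hone : ζ = 1 ↔ (Q : ℤ) ∣ t := by
    rw [hζ, Complex.exp_eq_one_iff]
    have h2 : (2 * Real.pi * Complex.I : ℂ) ≠ 0 := Complex.two_pi_I_ne_zero
    constructor
    · rintro ⟨n, hn⟩
      refine ⟨n, ?_⟩
      have : (t : ℂ) = (Q : ℂ) * n := by
        field_simp at hn
        linear_combination hn
      exact_mod_cast this
    · rintro ⟨n, rfl⟩
      exact ⟨n, by push_cast; field_simp⟩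
  simp only [h1]
  split_ifs with h
  · simp [hone.2 h]
  · have hne : ζ - 1 ≠ 0 := sub_ne_zero.2 fun h' => h (hone.1 h')
    have := geom_sum_mul ζ Q
    rw [hpow, sub_self] at this
    exact (mul_eq_zero.1 this).resolve_right hne

/-! ### Characters in a one-dimensional feature state -/

/-- The increasing bijection from `ℤ` onto the nonzero integers which fixes the negative ones; in
terms of `skip`, the enumeration `enum` is a translation. -/
def skip (u : ℤ) : ℤ := if u < 0 then u else u + 1

theorem sum_freqs₁ {E : Type*} [AddCommMonoid E] (q : ℕ) (F : ℤ → E) :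
    ∑ a ∈ freqs₁ q, F a = ∑ u ∈ Finset.Ico (-2 ^ (q - 1) : ℤ) (2 ^ (q - 1)), F (skip u) := by
  refine (Finset.sum_bij (fun u _ => skip u) ?_ ?_ ?_ fun _ _ => rfl).symm
  · intro u hu
    simp only [freqs₁, Finset.mem_erase, Finset.mem_Icc, Finset.mem_Ico, skip] at hu ⊢
    split_ifs <;> omega
  · intro u _ v _ h
    simp only [skip] at h
    split_ifs at h <;> omega
  · intro a ha
    simp only [freqs₁, Finset.mem_erase, Finset.mem_Icc] at ha
    by_cases h : a < 0
    · exact ⟨a, by rw [Finset.mem_Ico]; omega, by simp [skip, h]⟩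
    · refine ⟨a - 1, by rw [Finset.mem_Ico]; omega, ?_⟩
      rw [skip, if_neg (by omega)]; ring

theorem enum_skip (q : ℕ) (u : ℤ) : enum q (skip u) = (u + 2 ^ (q - 1)).toNat := by
  unfold enum skip
  split_ifs <;> omega

/-- Plancherel on `ℤ/Q` with a character inserted. -/
theorem sum_exp_mul_norm_sq {Q : ℕ} (hQ : Q ≠ 0) (m : ℤ) (s : Finset ℤ) (c : ℤ → ℂ) (o : ℤ → ℤ) :
    ∑ k ∈ Finset.range Q, Complex.exp (2 * Real.pi * Complex.I * m * k / Q) *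
      (‖∑ u ∈ s, c u * Complex.exp (-2 * Real.pi * Complex.I * k * o u / Q)‖ ^ 2 : ℝ) =
    ∑ u ∈ s, ∑ v ∈ s, if (Q : ℤ) ∣ m + o u - o v then Q * (conj (c u) * c v) else 0 := by
  have h (k : ℕ) : Complex.exp (2 * Real.pi * Complex.I * m * k / Q) *
      (‖∑ u ∈ s, c u * Complex.exp (-2 * Real.pi * Complex.I * k * o u / Q)‖ ^ 2 : ℝ) =
      ∑ u ∈ s, ∑ v ∈ s, conj (c u) * c v *
        Complex.exp (2 * Real.pi * Complex.I * (m + o u - o v : ℤ) * k / Q) := by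
    rw [← Complex.normSq_eq_norm_sq, Complex.normSq_eq_conj_mul_self, map_sum, Finset.sum_mul_sum,
      Finset.mul_sum]
    refine Finset.sum_congr rfl fun u _ => ?_
    rw [Finset.mul_sum]
    refine Finset.sum_congr rfl fun v _ => ?_
    rw [map_mul, ← Complex.exp_conj]
    have : Complex.exp (2 * Real.pi * Complex.I * (m + o u - o v : ℤ) * k / Q) =
        Complex.exp (2 * Real.pi * Complex.I * m * k / Q) *
        Complex.exp (conj (-2 * Real.pi * Complex.I * k * o u / Q)) *
        Complex.exp (-2 * Real.pi * Complex.I * k * o v / Q) := by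
      rw [← Complex.exp_add, ← Complex.exp_add]
      congr 1
      simp only [map_mul, map_div₀, map_neg, map_ofNat, Complex.conj_ofReal, Complex.conj_I,
        map_natCast, map_intCast]
      push_cast
      ring
    rw [this]
    ring
  simp only [h]
  rw [Finset.sum_comm]
  refine Finset.sum_congr rfl fun u _ => ?_
  rw [Finset.sum_comm]
  refine Finset.sum_congr rfl fun v _ => ?_
  rw [← Finset.mul_sum, sum_exp_eq_ite hQ]
  split_ifs <;> ring

/-- The window `[-N, N)` contains exactly one representative of `t` modulo `2 * N`. -/
theorem sum_Ico_ite_dvd {E : Type*} [AddCommMonoid E] {N : ℤ} (hN : 0 < N) (t : ℤ) (F : ℤ → E) :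
    (∑ v ∈ Finset.Ico (-N) N, if 2 * N ∣ t - v then F v else 0) =
      F ((t + N) % (2 * N) - N) := by
  have h0 := Int.emod_nonneg (t + N) (show 2 * N ≠ 0 by omega)
  have h1 := Int.emod_lt_of_pos (t + N) (show 0 < 2 * N by omega)
  rw [Finset.sum_eq_single ((t + N) % (2 * N) - N), if_pos]
  · refine ⟨(t + N) / (2 * N), ?_⟩
    have := Int.emod_add_mul_ediv (t + N) (2 * N)
    linarith
  · intro v hv hne
    rw [Finset.mem_Ico] at hv
    refine if_neg fun ⟨k, hk⟩ => hne ?_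
    have : t + N = (v + N) + 2 * N * k := by linarith
    rw [this, Int.add_mul_emod_self_left, Int.emod_eq_of_lt (by omega) (by omega)]
    ring
  · intro h
    exact absurd (Finset.mem_Ico.2 ⟨by omega, by omega⟩) h

/-- The weight `e^{-τ |a|^p / 2}` of the frequency `a = skip u`. -/
def weight (p τ : ℝ) (u : ℤ) : ℝ := Real.exp (-τ * |(skip u : ℝ)| ^ p / 2)

/-- The function `ψ_a^* ψ_b` on the circle, with `a = skip u` and `b = skip v`. -/
def crossTerm (p τ : ℝ) (u v : ℤ) : C(UnitAddCircle, ℂ) :=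
  ((weight p τ u * weight p τ v : ℝ) : ℂ) • fourier (skip v - skip u)

/-- `charMean` as a continuous function of the point, written as a cyclic correlation. -/
def cyclicCorrelation (q : ℕ) (p τ : ℝ) (m : ℤ) : C(UnitAddCircle, ℂ) :=
  ((∑ u ∈ Finset.Ico (-2 ^ (q - 1) : ℤ) (2 ^ (q - 1)), weight p τ u ^ 2 : ℝ) : ℂ)⁻¹ •
    ∑ u ∈ Finset.Ico (-2 ^ (q - 1) : ℤ) (2 ^ (q - 1)),
      crossTerm p τ u ((m + u + 2 ^ (q - 1)) % (2 * 2 ^ (q - 1)) - 2 ^ (q - 1))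

theorem charMean_eq {q : ℕ} (hq : q ≠ 0) (p τ : ℝ) (m : ℤ) (y : UnitAddCircle) :
    charMean q p τ m y = cyclicCorrelation q p τ m y := by
  obtain ⟨r, rfl⟩ := Nat.exists_eq_succ_of_ne_zero hq
  simp only [Nat.succ_eq_add_one, cyclicCorrelation, Nat.add_sub_cancel]
  set N : ℤ := 2 ^ r with hN
  have hN0 : 0 < N := by positivity
  have hQN : ((2 ^ (r + 1) : ℕ) : ℤ) = 2 * N := by rw [hN]; push_cast; ring
  set S : ℝ := ∑ u ∈ Finset.Ico (-N) N, weight p τ u ^ 2 with hS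
  have hS0 : 0 ≤ S := Finset.sum_nonneg fun u _ => sq_nonneg _
  have hw (u : ℤ) : Real.exp (-τ * |(skip u : ℝ)| ^ p) = weight p τ u ^ 2 := by
    rw [weight, ← Real.exp_nat_mul]; congr 1; push_cast; ring
  let c : ℤ → ℂ := fun u => ((Real.sqrt S)⁻¹ : ℂ) * (weight p τ u * fourier (skip u) y) *
    ((Real.sqrt (2 ^ (r + 1)))⁻¹ : ℂ)
  have hamp (b : Fin (r + 1) → Bool) : amplitude (r + 1) p τ y b =
      ∑ u ∈ Finset.Ico (-N) N, c u *
        Complex.exp (-2 * Real.pi * Complex.I * ofBits b * (u + N : ℤ) / (2 ^ (r + 1) : ℕ)) := by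
    rw [amplitude, sum_freqs₁, sum_freqs₁, Nat.add_sub_cancel]
    refine Finset.sum_congr rfl fun u hu => ?_
    rw [Finset.mem_Ico] at hu
    have hlt : (u + N).toNat < 2 ^ (r + 1) := by omega
    have hcast : (((u + N).toNat : ℕ) : ℂ) = ((u + N : ℤ) : ℂ) := by
      rw [← Int.cast_natCast, Int.toNat_of_nonneg (by omega)]
    rw [enum_skip, Nat.add_sub_cancel, ← hN, qftEntry, ofBits_toBits hlt, hcast]
    simp only [hw, ← hS, c]
    rw [show Real.exp (-τ * |(skip u : ℝ)| ^ p / 2) = weight p τ u from rfl]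
    push_cast
    ring
  have hfour (k : ℕ) : fourier m (((k : ℝ) / 2 ^ (r + 1) : ℝ) : UnitAddCircle) =
      Complex.exp (2 * Real.pi * Complex.I * m * k / (2 ^ (r + 1) : ℕ)) := by
    rw [fourier_coe_apply]; congr 1; push_cast; ring
  simp only [charMean, hamp]
  rw [sum_ofBits fun k => fourier m (((k : ℝ) / 2 ^ (r + 1) : ℝ) : UnitAddCircle) *
    ((‖∑ u ∈ Finset.Ico (-N) N, c u * Complex.exp (-2 * Real.pi * Complex.I * k *
      (u + N : ℤ) / (2 ^ (r + 1) : ℕ))‖ ^ 2 : ℝ) : ℂ)]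
  simp only [hfour]
  rw [sum_exp_mul_norm_sq (by positivity) m _ c fun u => u + N]
  have hc (u v : ℤ) : ((2 ^ (r + 1) : ℕ) : ℂ) * (conj (c u) * c v) =
      (S : ℂ)⁻¹ * crossTerm p τ u v y := by
    have h1 : ((Real.sqrt S : ℂ))⁻¹ * ((Real.sqrt S : ℂ))⁻¹ = (S : ℂ)⁻¹ := by
      rw [← mul_inv, ← Complex.ofReal_mul, Real.mul_self_sqrt hS0]
    have h2 : ((Real.sqrt (2 ^ (r + 1)) : ℂ))⁻¹ * ((Real.sqrt (2 ^ (r + 1)) : ℂ))⁻¹ =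
        ((2 ^ (r + 1) : ℕ) : ℂ)⁻¹ := by
      rw [← mul_inv, ← Complex.ofReal_mul, Real.mul_self_sqrt (by positivity)]
      push_cast; rfl
    have h3 : ((2 ^ (r + 1) : ℕ) : ℂ) * ((2 ^ (r + 1) : ℕ) : ℂ)⁻¹ = 1 :=
      mul_inv_cancel₀ (by exact_mod_cast (by positivity : (2 ^ (r + 1) : ℕ) ≠ 0))
    have h4 : fourier (skip v - skip u) y = conj (fourier (skip u) y) * fourier (skip v) y := by
      rw [← fourier_neg, ← fourier_add]; congr 2; ring
    simp only [c, crossTerm, ContinuousMap.smul_apply, smul_eq_mul, h4, map_mul, map_inv₀,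
      Complex.conj_ofReal, Complex.ofReal_mul]
    have h5 : ((Real.sqrt S : ℂ))⁻¹ * ((Real.sqrt S : ℂ))⁻¹ * (((Real.sqrt (2 ^ (r + 1)) : ℂ))⁻¹ *
        ((Real.sqrt (2 ^ (r + 1)) : ℂ))⁻¹) = (S : ℂ)⁻¹ * ((2 ^ (r + 1) : ℕ) : ℂ)⁻¹ := by
      rw [h1, h2]
    linear_combination (weight p τ u * weight p τ v * conj (fourier (skip u) y) *
      fourier (skip v) y) * (((2 ^ (r + 1) : ℕ) : ℂ) * h5 + (S : ℂ)⁻¹ * h3)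
  rw [ContinuousMap.smul_apply, ContinuousMap.sum_apply, smul_eq_mul, Finset.mul_sum]
  refine Finset.sum_congr rfl fun u _ => ?_
  simp only [hc]
  rw [← sum_Ico_ite_dvd hN0 (m + u) fun v => (S : ℂ)⁻¹ * crossTerm p τ u v y, hQN]
  refine Finset.sum_congr rfl fun v _ => ?_
  rw [add_sub_assoc, add_sub_add_right_eq_sub, ← add_sub_assoc]

/-! ### The limit of many qubits -/

theorem summable_exp_neg_mul_rpow {c p : ℝ} (hc : 0 < c) (hp : 0 < p) :
    Summable fun n : ℕ => Real.exp (-c * (n : ℝ) ^ p) := by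
  have h1 : Tendsto (fun n : ℕ => (n : ℝ) ^ p) atTop atTop :=
    (tendsto_rpow_atTop hp).comp tendsto_natCast_atTop_atTop
  have h2 := ((isLittleO_exp_neg_mul_rpow_atTop hc (-2 / p)).comp_tendsto h1).isBigO
  refine summable_of_isBigO_nat (Real.summable_nat_rpow.2 (by norm_num : (-2 : ℝ) < -1)) ?_
  refine h2.congr' .rfl (.of_forall fun n => ?_)
  simp only [Function.comp]
  rw [← Real.rpow_mul n.cast_nonneg, mul_div_cancel₀ _ hp.ne']

theorem weight_pos (p τ : ℝ) (u : ℤ) : 0 < weight p τ u := Real.exp_pos _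

theorem weight_le_one {p τ : ℝ} (hτ : 0 ≤ τ) (u : ℤ) : weight p τ u ≤ 1 := by
  rw [weight, Real.exp_le_one_iff]
  have : 0 ≤ τ * |(skip u : ℝ)| ^ p := by positivity
  linarith

theorem abs_le_abs_skip (u : ℤ) : |u| ≤ |skip u| := by
  unfold skip
  split_ifs with h
  · exact le_rfl
  · rw [abs_of_nonneg (by omega), abs_of_nonneg (by omega)]; omega

theorem summable_weight {p τ : ℝ} (hp : 0 < p) (hτ : 0 < τ) : Summable (weight p τ) := by
  have hle (u : ℤ) : weight p τ u ≤ Real.exp (-(τ / 2) * (|u| : ℝ) ^ p) := by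
    rw [weight, Real.exp_le_exp]
    have h1 : (|u| : ℝ) ^ p ≤ |(skip u : ℝ)| ^ p :=
      Real.rpow_le_rpow (abs_nonneg _) (by exact_mod_cast abs_le_abs_skip u) hp.le
    nlinarith
  have hs := summable_exp_neg_mul_rpow (half_pos hτ) hp
  refine Summable.of_nonneg_of_le (fun u => (weight_pos p τ u).le) hle (.of_nat_of_neg ?_ ?_) <;>
  simpa using hs

theorem summable_weight_sq {p τ : ℝ} (hp : 0 < p) (hτ : 0 < τ) :
    Summable fun u => weight p τ u ^ 2 :=
  (summable_weight hp hτ).of_nonneg_of_le (fun _ => sq_nonneg _) fun u => by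
    nlinarith [weight_pos p τ u, weight_le_one (p := p) hτ.le u]

theorem norm_crossTerm (p τ : ℝ) (u v : ℤ) :
    ‖crossTerm p τ u v‖ = weight p τ u * weight p τ v := by
  rw [crossTerm, norm_smul, fourier_norm, mul_one, Complex.norm_real, Real.norm_of_nonneg]
  exact (mul_pos (weight_pos _ _ _) (weight_pos _ _ _)).le

theorem norm_crossTerm_le {p τ : ℝ} (hτ : 0 ≤ τ) (u v : ℤ) :
    ‖crossTerm p τ u v‖ ≤ weight p τ u := by
  rw [norm_crossTerm]
  exact mul_le_of_le_one_right (weight_pos _ _ _).le (weight_le_one hτ v)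

theorem tendsto_two_pow_pred : Tendsto (fun q : ℕ => (2 : ℤ) ^ (q - 1)) atTop atTop :=
  (tendsto_pow_atTop_atTop_of_one_lt (by norm_num)).comp (tendsto_sub_atTop_nat 1)

/-- Dominated convergence for sums over growing windows, with terms that are eventually constant. -/
theorem tendsto_sum_Ico_of_dominated {E : Type*} [NormedAddCommGroup E] [CompleteSpace E]
    {N : ℕ → ℤ} (hN : Tendsto N atTop atTop) {g : ℕ → ℤ → E} {g' : ℤ → E} {B : ℤ → ℝ}
    (hB : Summable B) (hg : ∀ q u, ‖g q u‖ ≤ B u)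
    (hlim : ∀ u, ∀ᶠ q in atTop, g q u = g' u) :
    Tendsto (fun q => ∑ u ∈ Finset.Ico (-N q) (N q), g q u) atTop (𝓝 (∑' u, g' u)) := by
  have h (q : ℕ) : ∑ u ∈ Finset.Ico (-N q) (N q), g q u =
      ∑' u, (Finset.Ico (-N q) (N q) : Set ℤ).indicator (g q) u :=
    (Finset.sum_congr rfl fun u hu => (Set.indicator_of_mem (Finset.mem_coe.2 hu) _).symm).trans
      (tsum_eq_sum fun u hu => Set.indicator_of_notMem (by simpa using hu) _).symm
  simp only [h]
  refine tendsto_tsum_of_dominated_convergence hB (fun u => ?_) (.of_forall fun q u => ?_)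
  · refine tendsto_const_nhds.congr' ?_
    filter_upwards [hlim u, hN.eventually_gt_atTop |u|] with q hq hu
    rw [Set.indicator_of_mem, hq]
    have := abs_lt.1 hu
    rw [Finset.mem_coe, Finset.mem_Ico]; omega
  · exact (norm_indicator_le_norm_self _ _).trans (hg q u)

/-- The expectation of the Fourier function `φ_m` of the circle in the limit of many qubits, where
the cyclic correlation becomes a correlation on `ℤ`. -/
def charLimit (p τ : ℝ) (m : ℤ) : C(UnitAddCircle, ℂ) :=
  ((∑' u, weight p τ u ^ 2 : ℝ) : ℂ)⁻¹ • ∑' u, crossTerm p τ u (m + u)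

theorem tsum_weight_sq_pos {p τ : ℝ} (hp : 0 < p) (hτ : 0 < τ) : 0 < ∑' u, weight p τ u ^ 2 :=
  (summable_weight_sq hp hτ).tsum_pos (fun _ => sq_nonneg _) 0 (pow_pos (weight_pos _ _ _) 2)

theorem tendsto_cyclicCorrelation {p τ : ℝ} (hp : 0 < p) (hτ : 0 < τ) (m : ℤ) :
    Tendsto (fun q => cyclicCorrelation q p τ m) atTop (𝓝 (charLimit p τ m)) := by
  refine Tendsto.smul (Tendsto.inv₀ (Complex.continuous_ofReal.continuousAt.tendsto.comp ?_)
    (by exact_mod_cast (tsum_weight_sq_pos hp hτ).ne')) ?_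
  · refine tendsto_sum_Ico_of_dominated tendsto_two_pow_pred (summable_weight_sq hp hτ)
      (g := fun _ u => weight p τ u ^ 2) (fun q u => ?_) fun u => .of_forall fun _ => rfl
    rw [Real.norm_of_nonneg (sq_nonneg _)]
  · refine tendsto_sum_Ico_of_dominated tendsto_two_pow_pred (summable_weight hp hτ)
      (fun q u => norm_crossTerm_le hτ.le _ _) fun u => ?_
    -- for a fixed `u`, the cyclic shift by `m` does not wrap around once the window is large
    filter_upwards [tendsto_two_pow_pred.eventually_gt_atTop |m + u|] with q hq
    have := abs_lt.1 hq
    rw [Int.emod_eq_of_lt (by omega) (by omega), add_sub_cancel_right]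

/-! ### The limit of small `τ` -/

theorem abs_rpow_sub_rpow_le {p : ℝ} (hp₀ : 0 ≤ p) (hp₁ : p ≤ 1) {a b : ℝ} (ha : 0 ≤ a)
    (hb : 0 ≤ b) : |a ^ p - b ^ p| ≤ |a - b| ^ p := by
  wlog hab : b ≤ a generalizing a b
  · rw [abs_sub_comm, abs_sub_comm a]; exact this hb ha (le_of_not_ge hab)
  rw [abs_of_nonneg (sub_nonneg.2 (Real.rpow_le_rpow hb hab hp₀)), abs_of_nonneg (sub_nonneg.2 hab)]
  have := Real.rpow_add_le_add_rpow (sub_nonneg.2 hab) hb hp₀ hp₁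
  rw [sub_add_cancel] at this
  linarith

theorem abs_exp_sub_one_le_of_abs_le {x y : ℝ} (h : |x| ≤ y) :
    |Real.exp x - 1| ≤ Real.exp y - 1 := by
  obtain ⟨h1, h2⟩ := abs_le.1 h
  have h3 := Real.exp_le_exp.2 h2
  rw [abs_le]
  constructor <;> linarith [Real.add_one_le_exp x, Real.add_one_le_exp y]

theorem skip_add_sub_skip {m u : ℤ} (hu : |m| < |u|) : skip (m + u) - skip u = m := by
  unfold skip
  split_ifs <;> grind

theorem abs_skip_add_sub_skip_le (m u : ℤ) : |skip (m + u) - skip u| ≤ |m| + 1 := by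
  unfold skip
  split_ifs <;> grind

/-- The shifted weight differs from the weight by a factor close to `1`: as `p ≤ 1`, the exponents
`|a|^p` and `|b|^p` differ by at most `|a - b|^p`. -/
theorem abs_weight_mul_weight_sub_sq_le {p τ : ℝ} (hp₀ : 0 ≤ p) (hp₁ : p ≤ 1) (hτ : 0 ≤ τ)
    (m u : ℤ) : |weight p τ u * weight p τ (m + u) - weight p τ u ^ 2| ≤
      weight p τ u ^ 2 * (Real.exp (τ * ((|m| : ℝ) + 1) ^ p / 2) - 1) := by
  set a := |(skip u : ℝ)|
  set b := |(skip (m + u) : ℝ)|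
  have hab : |a ^ p - b ^ p| ≤ ((|m| : ℝ) + 1) ^ p := by
    refine (abs_rpow_sub_rpow_le hp₀ hp₁ (abs_nonneg _) (abs_nonneg _)).trans ?_
    refine Real.rpow_le_rpow (abs_nonneg _) ?_ hp₀
    refine (abs_abs_sub_abs_le_abs_sub _ _).trans ?_
    rw [abs_sub_comm]
    exact_mod_cast abs_skip_add_sub_skip_le m u
  have hx : |τ * (a ^ p - b ^ p) / 2| ≤ τ * ((|m| : ℝ) + 1) ^ p / 2 := by
    rw [abs_div, abs_mul, abs_of_nonneg hτ, abs_two]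
    gcongr
  have hw : weight p τ (m + u) = weight p τ u * Real.exp (τ * (a ^ p - b ^ p) / 2) := by
    rw [weight, weight, ← Real.exp_add]; congr 1; ring
  rw [hw, show ∀ w e : ℝ, w * (w * e) - w ^ 2 = w ^ 2 * (e - 1) by intros; ring, abs_mul,
    abs_of_nonneg (sq_nonneg _)]
  gcongr
  exact abs_exp_sub_one_le_of_abs_le hx

/-- In the correlation of `ψ_u` with `ψ_{m+u}`, labelled through `skip`, an index `u` with
`|u| > |m|` contributes almost `φ_m`, since its shift by `m` does not cross the missing frequency
`0`. The finitely many others contribute a bounded error. -/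
theorem norm_crossTerm_sub_le {p τ : ℝ} (hp₀ : 0 ≤ p) (hp₁ : p ≤ 1) (hτ : 0 ≤ τ) (m u : ℤ) :
    ‖crossTerm p τ u (m + u) - ((weight p τ u ^ 2 : ℝ) : ℂ) • fourier m‖ ≤
      weight p τ u ^ 2 * (Real.exp (τ * ((|m| : ℝ) + 1) ^ p / 2) - 1) +
        (Finset.Icc (-|m|) |m| : Set ℤ).indicator (fun _ => 2) u := by
  have hsq : weight p τ u ^ 2 ≤ 1 := pow_le_one₀ (weight_pos _ _ _).le (weight_le_one hτ u)
  by_cases hu : |m| < |u|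
  · have h : crossTerm p τ u (m + u) - ((weight p τ u ^ 2 : ℝ) : ℂ) • fourier m =
        ((weight p τ u * weight p τ (m + u) - weight p τ u ^ 2 : ℝ) : ℂ) •
          (fourier m : C(UnitAddCircle, ℂ)) := by
      rw [crossTerm, skip_add_sub_skip hu, Complex.ofReal_sub]
      exact (sub_smul _ _ _).symm
    rw [h, norm_smul, fourier_norm, mul_one, Complex.norm_real, Real.norm_eq_abs]
    exact (abs_weight_mul_weight_sub_sq_le hp₀ hp₁ hτ m u).trans
      (le_add_of_nonneg_right (Set.indicator_nonneg (fun _ _ => zero_le_two) _))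
  · rw [Set.indicator_of_mem (by
      rw [Finset.mem_coe, Finset.mem_Icc]; exact abs_le.1 (not_lt.1 hu))]
    have h1 : (1 : ℝ) ≤ Real.exp (τ * ((|m| : ℝ) + 1) ^ p / 2) := Real.one_le_exp (by positivity)
    have h2 : ‖crossTerm p τ u (m + u)‖ ≤ 1 :=
      (norm_crossTerm_le hτ _ _).trans (weight_le_one hτ u)
    have h3 : ‖((weight p τ u ^ 2 : ℝ) : ℂ) • (fourier m : C(UnitAddCircle, ℂ))‖ ≤ 1 := by
      rw [norm_smul, fourier_norm, mul_one, Complex.norm_real, Real.norm_of_nonneg (sq_nonneg _)]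
      exact hsq
    have h4 : 0 ≤ weight p τ u ^ 2 * (Real.exp (τ * ((|m| : ℝ) + 1) ^ p / 2) - 1) :=
      mul_nonneg (sq_nonneg _) (sub_nonneg.2 h1)
    linarith [norm_sub_le (crossTerm p τ u (m + u))
      (((weight p τ u ^ 2 : ℝ) : ℂ) • (fourier m : C(UnitAddCircle, ℂ)))]

theorem norm_charLimit_sub_le {p τ : ℝ} (hp₀ : 0 < p) (hp₁ : p ≤ 1) (hτ : 0 < τ) (m : ℤ) :
    ‖charLimit p τ m - fourier m‖ ≤ (Real.exp (τ * ((|m| : ℝ) + 1) ^ p / 2) - 1) +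
      (∑' u, weight p τ u ^ 2)⁻¹ *
        ∑' u, (Finset.Icc (-|m|) |m| : Set ℤ).indicator (fun _ => (2 : ℝ)) u := by
  set K := ∑' u, weight p τ u ^ 2 with hK
  have hK0 : 0 < K := tsum_weight_sq_pos hp₀ hτ
  have hsum : Summable ((Finset.Icc (-|m|) |m| : Set ℤ).indicator (fun _ => (2 : ℝ))) :=
    summable_of_hasFiniteSupport ((Finset.finite_toSet _).subset Set.support_indicator_subset)
  have hc : Summable fun u => crossTerm p τ u (m + u) :=
    .of_norm_bounded (summable_weight hp₀ hτ) fun u => norm_crossTerm_le hτ.le _ _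
  have hw : Summable fun u => ((weight p τ u ^ 2 : ℝ) : ℂ) :=
    Complex.summable_ofReal.2 (summable_weight_sq hp₀ hτ)
  have heq : charLimit p τ m - fourier m = (K : ℂ)⁻¹ •
      ∑' u, (crossTerm p τ u (m + u) - ((weight p τ u ^ 2 : ℝ) : ℂ) • fourier m) := by
    rw [hc.tsum_sub (hw.smul_const _), hw.tsum_smul_const, ← Complex.ofReal_tsum, ← hK, smul_sub,
      inv_smul_smul₀ (by exact_mod_cast hK0.ne'), charLimit]
  rw [heq, norm_smul, norm_inv, Complex.norm_real, Real.norm_of_nonneg hK0.le]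
  have hB := (summable_weight_sq hp₀ hτ).mul_right (Real.exp (τ * ((|m| : ℝ) + 1) ^ p / 2) - 1)
  have h := tsum_of_norm_bounded (hB.add hsum).hasSum
    (norm_crossTerm_sub_le hp₀.le hp₁ hτ.le m)
  rw [hB.tsum_add hsum, tsum_mul_right, ← hK] at h
  refine (mul_le_mul_of_nonneg_left h (inv_nonneg.2 hK0.le)).trans_eq ?_
  rw [mul_add, inv_mul_cancel_left₀ hK0.ne']

theorem tendsto_tsum_weight_sq {p : ℝ} (hp : 0 < p) :
    Tendsto (fun τ => ∑' u, weight p τ u ^ 2) (𝓝[>] 0) atTop := by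
  refine tendsto_atTop.2 fun R => ?_
  obtain ⟨n, hn⟩ := exists_nat_gt R
  have hcont : Tendsto (fun τ => ∑ u ∈ Finset.Ico (0 : ℤ) n, weight p τ u ^ 2) (𝓝[>] 0)
      (𝓝 (∑ u ∈ Finset.Ico (0 : ℤ) n, weight p 0 u ^ 2)) := by
    refine Continuous.tendsto' ?_ _ _ rfl |>.mono_left nhdsWithin_le_nhds
    unfold weight
    fun_prop
  have h0 : ∑ u ∈ Finset.Ico (0 : ℤ) n, weight p 0 u ^ 2 = n := by simp [weight]
  filter_upwards [hcont.eventually_const_lt (h0 ▸ hn), self_mem_nhdsWithin] with τ h hτ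
  exact h.le.trans ((summable_weight_sq hp hτ).sum_le_tsum _ fun _ _ => sq_nonneg _)

theorem tendsto_charLimit {p : ℝ} (hp₀ : 0 < p) (hp₁ : p ≤ 1) (m : ℤ) :
    Tendsto (fun τ => charLimit p τ m) (𝓝[>] 0) (𝓝 (fourier m)) := by
  rw [tendsto_iff_norm_sub_tendsto_zero]
  have h1 : Tendsto (fun τ : ℝ => Real.exp (τ * ((|m| : ℝ) + 1) ^ p / 2) - 1) (𝓝[>] 0) (𝓝 0) :=
    (Continuous.tendsto' (by fun_prop) _ _ (by simp)).mono_left nhdsWithin_le_nhds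
  have h2 := (tendsto_inv_atTop_zero.comp (tendsto_tsum_weight_sq hp₀)).mul_const
    (∑' u, (Finset.Icc (-|m|) |m| : Set ℤ).indicator (fun _ => (2 : ℝ)) u)
  rw [zero_mul] at h2
  have h3 := h1.add h2
  rw [add_zero] at h3
  refine tendsto_of_tendsto_of_tendsto_of_le_of_le' tendsto_const_nhds h3
    (.of_forall fun _ => norm_nonneg _) ?_
  filter_upwards [self_mem_nhdsWithin] with τ hτ
  exact norm_charLimit_sub_le hp₀ hp₁ hτ m

/-! ### Bandlimited observables on the torus -/

theorem finite_lattice_seminorm_le {d : ℕ} (ν : Seminorm ℝ (Fin d → ℝ)) (hν : ∀ v, ν v = 0 → v = 0)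
    (R : ℝ) : {m : Fin d → ℤ | ν (fun i => (m i : ℝ)) ≤ R}.Finite := by
  have hcont : Continuous ν := ν.convexOn.locallyLipschitz.continuous
  -- `ν` dominates a multiple of the sup norm, by compactness of the unit sphere
  obtain ⟨c, hc, hle⟩ : ∃ c : ℝ, 0 < c ∧ ∀ v, c * ‖v‖ ≤ ν v := by
    rcases (Metric.sphere (0 : Fin d → ℝ) 1).eq_empty_or_nonempty with h | h
    · refine ⟨1, one_pos, fun v => ?_⟩
      by_cases hv : v = 0
      · simp [hv]
      · have : ‖v‖⁻¹ • v ∈ Metric.sphere (0 : Fin d → ℝ) 1 := by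
          simp [norm_smul, inv_mul_cancel₀ (norm_ne_zero_iff.2 hv)]
        rw [h] at this
        exact this.elim
    · obtain ⟨w, hw, hmin⟩ := (isCompact_sphere (0 : Fin d → ℝ) 1).exists_isMinOn h
        hcont.continuousOn
      have hw0 : w ≠ 0 := by
        rintro rfl
        simp at hw
      refine ⟨ν w, (apply_nonneg ν w).lt_of_ne fun h => hw0 (hν w h.symm), fun v => ?_⟩
      by_cases hv : v = 0
      · simp [hv]
      · have hmem : ‖v‖⁻¹ • v ∈ Metric.sphere (0 : Fin d → ℝ) 1 := by
          simp [norm_smul, inv_mul_cancel₀ (norm_ne_zero_iff.2 hv)]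
        have := hmin hmem
        simp only [Set.mem_ofPred_eq, map_smul_eq_mul, norm_inv, norm_norm] at this
        rw [mul_comm]
        rwa [← div_eq_inv_mul, le_div_iff₀' (norm_pos_iff.2 hv)] at this
  refine (Set.finite_Icc (fun _ : Fin d => -⌈R / c⌉) fun _ => ⌈R / c⌉).subset fun m hm => ?_
  have hi (i : Fin d) : |m i| ≤ ⌈R / c⌉ := by
    have h1 : |(m i : ℝ)| ≤ ‖fun i => (m i : ℝ)‖ := norm_le_pi_norm (fun i => (m i : ℝ)) i
    have h2 : |(m i : ℝ)| ≤ R / c := by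
      rw [le_div_iff₀' hc]
      exact (mul_le_mul_of_nonneg_left h1 hc.le).trans ((hle _).trans hm)
    exact_mod_cast h2.trans (Int.le_ceil _)
  exact ⟨fun i => (abs_le.1 (hi i)).1, fun i => (abs_le.1 (hi i)).2⟩

/-- The frequencies `m` with `|m| ≤ M`. -/
def bandFreqs {d : ℕ} {ν : Seminorm ℝ (Fin d → ℝ)} (hν : ∀ v, ν v = 0 → v = 0) (M : ℕ) :
    Finset (Fin d → ℤ) :=
  (finite_lattice_seminorm_le ν hν M).toFinset

theorem bandlimit_eq_sum {d : ℕ} {ν : Seminorm ℝ (Fin d → ℝ)} (hν : ∀ v, ν v = 0 → v = 0)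
    (f : C(Torus d, ℂ)) (M : ℕ) (x : Torus d) :
    bandlimit ν f M x = ∑ m ∈ bandFreqs hν M,
      UnitAddTorus.mFourierCoeff f m * UnitAddTorus.mFourier m x := by
  rw [bandlimit, bandFreqs]
  exact finsum_mem_eq_finite_toFinset_sum _ (finite_lattice_seminorm_le ν hν M)

theorem tendsto_bandFreqs {d : ℕ} {ν : Seminorm ℝ (Fin d → ℝ)} (hν : ∀ v, ν v = 0 → v = 0) :
    Tendsto (bandFreqs hν) atTop atTop := by
  refine tendsto_atTop_finset_of_monotone (fun M M' h m hm => ?_) fun m => ?_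
  · simp only [bandFreqs, Set.Finite.mem_toFinset, Set.mem_ofPred_eq] at hm ⊢
    exact hm.trans (by exact_mod_cast h)
  · obtain ⟨M, hM⟩ := exists_nat_ge (ν fun i => (m i : ℝ))
    exact ⟨M, by simpa [bandFreqs] using hM⟩

/-- The function `x ↦ ∏ i, F i (x i)` on the torus. -/
def tensor {d : ℕ} (F : Fin d → C(UnitAddCircle, ℂ)) : C(Torus d, ℂ) :=
  ∏ i, (F i).comp ⟨fun x : Torus d => x i, continuous_apply i⟩

theorem tensor_apply {d : ℕ} (F : Fin d → C(UnitAddCircle, ℂ)) (x : Torus d) :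
    tensor F x = ∏ i, F i (x i) := by
  simp [tensor, ContinuousMap.prod_apply]

theorem tensor_fourier {d : ℕ} (m : Fin d → ℤ) :
    tensor (fun i => fourier (m i)) = UnitAddTorus.mFourier m := by
  ext x
  rw [tensor_apply]
  rfl

theorem tendsto_tensor {d : ℕ} {α : Type*} {l : Filter α} {F : α → Fin d → C(UnitAddCircle, ℂ)}
    {G : Fin d → C(UnitAddCircle, ℂ)} (h : ∀ i, Tendsto (fun a => F a i) l (𝓝 (G i))) :
    Tendsto (fun a => tensor (F a)) l (𝓝 (tensor G)) :=
  tendsto_finsetProd _ fun i _ =>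
    ((ContinuousMap.continuous_precomp _).tendsto (G i)).comp (h i)

theorem expectation_obsD {d q : ℕ} (hq : q ≠ 0) (p τ : ℝ) {ν : Seminorm ℝ (Fin d → ℝ)}
    (hν : ∀ v, ν v = 0 → v = 0) (f : C(Torus d, ℂ)) (M : ℕ) (x : Torus d) :
    expectation (rotatedState q p τ x) (obsD q ν f M) =
      (∑ m ∈ bandFreqs hν M, UnitAddTorus.mFourierCoeff f m •
        tensor fun i => cyclicCorrelation q p τ (m i)) x := by
  have h (m : Fin d → ℤ) : tensor (fun i => cyclicCorrelation q p τ (m i)) x =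
      expectation (rotatedState q p τ x) (diagObs q (UnitAddTorus.mFourier m)) := by
    rw [expectation_mFourier, tensor_apply]
    exact Finset.prod_congr rfl fun i _ => (charMean_eq hq _ _ _ _).symm
  simp only [ContinuousMap.sum_apply, ContinuousMap.smul_apply, smul_eq_mul, h, obsD,
    expectation_diagObs, bandlimit_eq_sum hν, Finset.sum_mul, Finset.mul_sum, mul_assoc]
  exact Finset.sum_comm

/-! ### Choice of the sequence `τ_M` -/

/-- If `F M τ → G M` as `τ → 0+` for every `M`, and `G M → g`, then `F M (τ_M) → g` for a suitable
sequence `τ_M`, chosen among the numbers `1 / (k + 1)`. -/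
theorem exists_strictAnti_tendsto_diagonal {E : Type*} [PseudoMetricSpace E] {F : ℕ → ℝ → E}
    {G : ℕ → E} {g : E} (hF : ∀ M, Tendsto (F M) (𝓝[>] 0) (𝓝 (G M)))
    (hG : Tendsto G atTop (𝓝 g)) :
    ∃ τ : ℕ → ℝ, (∀ M, 0 < τ M) ∧ StrictAnti τ ∧ Tendsto τ atTop (𝓝 0) ∧
      Tendsto (fun M => F M (τ M)) atTop (𝓝 g) := by
  have hseq : Tendsto (fun k : ℕ => 1 / ((k : ℝ) + 1)) atTop (𝓝[>] 0) :=
    tendsto_nhdsWithin_iff.2 ⟨tendsto_one_div_add_atTop_nhds_zero_nat,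
      .of_forall fun k => Set.mem_Ioi.2 Nat.one_div_pos_of_nat⟩
  obtain ⟨φ, hφ, hd⟩ := extraction_forall_of_eventually
    (P := fun M k => dist (F M (1 / ((k : ℝ) + 1))) (G M) < 1 / ((M : ℝ) + 1)) fun M =>
      ((hF M).comp hseq).eventually (Metric.ball_mem_nhds _ Nat.one_div_pos_of_nat)
  refine ⟨fun M => 1 / ((φ M : ℝ) + 1), fun M => Nat.one_div_pos_of_nat,
    fun M M' h => Nat.one_div_lt_one_div (hφ h),
    tendsto_one_div_add_atTop_nhds_zero_nat.comp hφ.tendsto_atTop, ?_⟩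
  refine (tendsto_iff_of_dist ?_).2 hG
  exact squeeze_zero (fun _ => dist_nonneg) (fun M => (hd M).le)
    tendsto_one_div_add_atTop_nhds_zero_nat

end

end QECD

open QECD

theorem mainTheorem1 (d : ℕ) (hd : 1 ≤ d) (p : ℝ) (hp₀ : 0 < p) (hp₁ : p < 1)
    (ν : Seminorm ℝ (Fin d → ℝ)) (hν : ∀ v, ν v = 0 → v = 0)
    (f : C(QECD.Torus d, ℂ)) (hf : QECD.IsWiener f) :
    ∃ τ : ℕ → ℝ, (∀ M, 0 < τ M) ∧ StrictAnti τ ∧ Tendsto τ atTop (𝓝 0) ∧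
      (∃ D : ℕ → QECD.Torus d → ℂ,
        (∀ M, TendstoUniformly
          (fun (q : ℕ) (x : QECD.Torus d) =>
            QECD.expectation (QECD.rotatedState q p (τ M) x) (QECD.obsD q ν f M))
          (D M) atTop) ∧
        TendstoUniformly D (fun x => f x) atTop) ∧
      (∃ E : ℕ → QECD.Torus d → ℂ,
        (∀ M, TendstoUniformly
          (fun (q : ℕ) (x : QECD.Torus d) =>
            QECD.expectation (QECD.rotatedState q p (τ M) x) (QECD.obsE q ν f M))
          (E M) atTop) ∧
        TendstoUniformly E (fun x => ((f x).re : ℂ)) atTop) := by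
  let F : ℕ → ℝ → C(Torus d, ℂ) := fun M τ => ∑ m ∈ bandFreqs hν M,
    UnitAddTorus.mFourierCoeff f m • tensor fun i => charLimit p τ (m i)
  have hF (M : ℕ) : Tendsto (F M) (𝓝[>] 0) (𝓝 (∑ m ∈ bandFreqs hν M,
      UnitAddTorus.mFourierCoeff f m • UnitAddTorus.mFourier m)) :=
    tendsto_finsetSum _ fun m _ => by
      rw [← tensor_fourier]
      exact (tendsto_tensor fun i => tendsto_charLimit hp₀ hp₁.le (m i)).const_smul _
  have hG : Tendsto (fun M => ∑ m ∈ bandFreqs hν M,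
      UnitAddTorus.mFourierCoeff f m • UnitAddTorus.mFourier m) atTop (𝓝 f) :=
    (UnitAddTorus.hasSum_mFourier_series_of_summable (.of_norm hf)).comp (tendsto_bandFreqs hν)
  obtain ⟨τ, hτ, hanti, hτ0, hlim⟩ := exists_strictAnti_tendsto_diagonal hF hG
  have hinner (M : ℕ) : TendstoUniformly
      (fun (q : ℕ) (x : Torus d) => expectation (rotatedState q p (τ M) x) (obsD q ν f M))
      (F M (τ M)) atTop := by
    have h : Tendsto (fun q => ∑ m ∈ bandFreqs hν M, UnitAddTorus.mFourierCoeff f m •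
        tensor fun i => cyclicCorrelation q p (τ M) (m i)) atTop (𝓝 (F M (τ M))) :=
      tendsto_finsetSum _ fun m _ =>
        (tendsto_tensor fun i => tendsto_cyclicCorrelation hp₀ (hτ M) (m i)).const_smul _
    refine (tendstoUniformly_congr ?_).1 (ContinuousMap.tendsto_iff_tendstoUniformly.1 h)
    filter_upwards [eventually_ne_atTop 0] with q hq
    exact funext fun x => (expectation_obsD hq p (τ M) hν f M x).symm
  have houter := ContinuousMap.tendsto_iff_tendstoUniformly.1 hlim
  have hre : UniformContinuous fun z : ℂ => (z.re : ℂ) :=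
    (Complex.ofRealCLM.comp Complex.reCLM).uniformContinuous
  refine ⟨τ, hτ, hanti, hτ0, ⟨fun M => F M (τ M), hinner, houter⟩,
    fun M x => ((F M (τ M) x).re : ℂ), fun M => ?_, hre.comp_tendstoUniformly houter⟩
  have h := hre.comp_tendstoUniformly (hinner M)
  refine (tendstoUniformly_congr (.of_forall fun q => funext fun x => ?_)).1 h
  exact (expectation_re p (τ M) x (bandlimit ν f M)).symm
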